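/- Let $0<c<p$ (unit cost and unit price), let $\mu>0$, $\alpha\ge 0$, and put $\kappa=\frac{p-c}{p}\in(0,1)$ and $S=\mu\sqrt{\kappa/(1-\kappa)}$. For an order quantity $q\ge 0$ and a demand $v\ge 0$ let $\pi(q,v)=p\min\{q,v\}-cq$. Let $\mathcal P$ be the set of probability measures on $[0,\infty)$, and for $\sigma\ge 0$ let $$\mathcal A_\sigma=\{G\in\mathcal P:\ \mathbb E_G[\tilde v]=\mu,\ \mathbb E_G[\tilde v^2]=\mu^2+\sigma^2\}.$$ For $F,G\in\mathcal P$ let $d_{\rm OT}(F,G)\in[0,\infty]$ be the optimal-transport cost, i.e. the infimum of $\int |u-v|^2\,d\Gamma(u,v)$ over all joint distributions $\Gamma$ with marginals $F$ and $G$, and let $d(F,\mathcal A_\sigma)=\inf_{G\in\mathcal A_\sigma} d_{\rm OT}(F,G)$. Consider the misspecification-averse problem and the ambiguity-averse (Scarf) problem $$\max_{q\ge 0}\ \inf_{F\in\mathcal P}\big\{\mathbb E_F[\pi(q,\tilde u)]+\alpha\, d(F,\mathcal A_\sigma)\big\},\qquad \max_{q\ge 0}\ \inf_{G\in\mathcal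 A_\sigma}\mathbb E_G[\pi(q,\tilde v)].$$ Suppose $\kappa\ge\frac12$. Then for every $\sigma\in[0,S]$ the first problem has a unique optimal order quantity $q^\star_\alpha(\sigma)$. The second problem has a unique optimal order quantity $q^\star_\infty(\sigma)$ for $\sigma\in[0,S)$ and a largest one, $q^\star_\infty(S)$, for $\sigma=S$. There is some $\sigma_\alpha$ with $0\le\sigma_\alpha<S$ such that $q^\star_\alpha$ is (weakly) decreasing in $\sigma$ on $[\sigma_\alpha,S]$, whereas the Scarf quantity $q^\star_\infty$ is (weakly) increasing in $\sigma$ on all of $[0,S]$. -/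

import Mathlib

open MeasureTheory Set
open scoped NNReal ENNReal

noncomputable section

namespace Newsvendor

/-- Profit of the newsvendor with unit price `p`, unit cost `c`, order quantity `q` and
realized demand `v ≥ 0`. -/
def profit (p c q : ℝ) (v : ℝ≥0) : ℝ := p * min q (v : ℝ) - c * q

/-- The profit margin `κ = (p - c) / p`. -/
def margin (p c : ℝ) : ℝ := (p - c) / p

/-- The mean-variance ambiguity set: the demand distributions on `[0, ∞)` with mean `μ` and
second moment `μ² + σ²`. -/
def ambiguitySet (μ σ : ℝ) : Set (ProbabilityMeasure ℝ≥0) :=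
  {G | Integrable (fun v : ℝ≥0 => (v : ℝ) ^ 2) (G : Measure ℝ≥0) ∧
    ∫ v : ℝ≥0, (v : ℝ) ∂(G : Measure ℝ≥0) = μ ∧
    ∫ v : ℝ≥0, (v : ℝ) ^ 2 ∂(G : Measure ℝ≥0) = μ ^ 2 + σ ^ 2}

/-- The joint distributions on `[0, ∞) × [0, ∞)` with marginals `F` and `G`. -/
def couplings (F G : ProbabilityMeasure ℝ≥0) : Set (Measure (ℝ≥0 × ℝ≥0)) :=
  {Γ | Γ.map Prod.fst = (F : Measure ℝ≥0) ∧ Γ.map Prod.snd = (G : Measure ℝ≥0)}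

/-- The optimal-transport cost for the quadratic cost function `|u - v|²`; it may be infinite. -/
def otCost (F G : ProbabilityMeasure ℝ≥0) : ℝ≥0∞ :=
  ⨅ Γ ∈ couplings F G, ∫⁻ x : ℝ≥0 × ℝ≥0, ENNReal.ofReal (((x.1 : ℝ) - (x.2 : ℝ)) ^ 2) ∂Γ

/-- The closeness of `F` to a set of distributions. -/
def distToSet (F : ProbabilityMeasure ℝ≥0) (A : Set (ProbabilityMeasure ℝ≥0)) : ℝ≥0∞ :=
  ⨅ G ∈ A, otCost F G

/-- The criterion of the ambiguity-averse (Scarf) newsvendor: the worst-case expected profit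
over the ambiguity set. -/
def scarfObjective (p c μ σ q : ℝ) : EReal :=
  ⨅ G ∈ ambiguitySet μ σ, ((∫ v, profit p c q v ∂(G : Measure ℝ≥0) : ℝ) : EReal)

/-- The criterion of the misspecification-averse newsvendor: the worst case, over all demand
distributions on `[0, ∞)`, of the expected profit plus `α` times the closeness to the
ambiguity set. -/
def misspecObjective (p c μ α σ q : ℝ) : EReal :=
  ⨅ F : ProbabilityMeasure ℝ≥0,
    ((∫ u, profit p c q u ∂(F : Measure ℝ≥0) : ℝ) : EReal) +
      ((ENNReal.ofReal α * distToSet F (ambiguitySet μ σ) : ℝ≥0∞) : EReal)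

/-- The optimal order quantities `q ≥ 0` for a criterion. -/
def optimalOrders (L : ℝ → EReal) : Set ℝ := {q | 0 ≤ q ∧ IsMaxOn L (Ici 0) q}

end Newsvendor

end

namespace Newsvendor

/-! Both problems are one saddle-point problem. Put `s = √(κ/(1-κ))`, so `p = c(1+s²)`. Two-point
demand laws indexed by `r` bound either criterion above by `twoPointBound`; at `r = s` this bound
does not depend on `q`. At one quantity `qs` it is attained, by a quadratic minorant whose mean is
fixed by the two moments (`le_integral_min`). The `r`-derivative at `s` has the sign of `qs - q`,
which excludes every other optimum (`optimalOrders_of_bounds`).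

The sales function is `min q (χ v)`: `χ = id` for Scarf, while misspecification aversion replaces it
by the infimal convolution `huber h`, `h = p/(2α)`, since transport cost can be minimized pointwise.
Then `qs` is explicit: affine in `σ` with slope `(s - 1/s)/2` for Scarf, and for `α > 0` a concave
quadratic near the right end, with its vertex to the left of that end. -/

/-! ### Moments and the quadratic minorant. -/

lemma integrable_coe_of_mem {μ σ : ℝ} {G : ProbabilityMeasure ℝ≥0} (hG : G ∈ ambiguitySet μ σ) :
    Integrable (fun v : ℝ≥0 => (v : ℝ)) (G : Measure ℝ≥0) := by
  refine ((integrable_const (1 : ℝ)).add hG.1).mono' (by fun_prop) (ae_of_all _ fun v => ?_)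
  have : (0 : ℝ) ≤ v := v.2
  simp only [Real.norm_eq_abs, abs_of_nonneg this, Pi.add_apply]
  nlinarith [sq_nonneg ((v : ℝ) - 1)]

lemma integral_quadratic_of_mem {μ σ : ℝ} {G : ProbabilityMeasure ℝ≥0}
    (hG : G ∈ ambiguitySet μ σ) (q d b : ℝ) :
    Integrable (fun v : ℝ≥0 => q - d * (b - v) ^ 2) (G : Measure ℝ≥0) ∧
    ∫ v : ℝ≥0, (q - d * (b - v) ^ 2) ∂(G : Measure ℝ≥0) = q - d * ((b - μ) ^ 2 + σ ^ 2) := by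
  have h1 := integrable_coe_of_mem hG
  have h2 := hG.1
  have e : (fun v : ℝ≥0 => q - d * (b - (v : ℝ)) ^ 2) =
      fun v : ℝ≥0 => (q - d * b ^ 2) + ((2 * d * b) * (v : ℝ) - d * (v : ℝ) ^ 2) := by
    funext v; ring
  have i1 := h1.const_mul (2 * d * b)
  have i2 := h2.const_mul d
  rw [e]
  refine ⟨(integrable_const _).add (i1.sub i2), ?_⟩
  rw [integral_add (integrable_const _) (show Integrable (fun v : ℝ≥0 =>
    2 * d * b * (v : ℝ) - d * (v : ℝ) ^ 2) (G : Measure ℝ≥0) from i1.sub i2), integral_sub i1 i2, integral_const_mul,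
    integral_const_mul, hG.2.1, hG.2.2]
  simp
  ring

lemma integrable_min {G : Measure ℝ≥0} [IsFiniteMeasure G] {q : ℝ} {χ : ℝ → ℝ}
    (hq : 0 ≤ q) (hχ : Measurable χ) (h0 : ∀ v, 0 ≤ v → 0 ≤ χ v) :
    Integrable (fun v : ℝ≥0 => min q (χ v)) G := by
  have hmeas : Measurable fun v : ℝ≥0 => min q (χ v) :=
    measurable_const.min (hχ.comp measurable_coe_nnreal_real)
  refine (integrable_const q).mono' hmeas.aestronglyMeasurable (ae_of_all _ fun v => ?_)
  rw [Real.norm_eq_abs, abs_of_nonneg (le_min hq (h0 v v.2))]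
  exact min_le_left _ _

/-- The worst-case expectation of `min q (χ v)` over the mean-variance set is bounded below by
its value at the two-point law on `μ - σ / s` and `μ + σ s`. -/
lemma le_integral_min {μ σ s : ℝ} (hs : 0 < s) (hσ : 0 ≤ σ)
    {G : ProbabilityMeasure ℝ≥0} (hG : G ∈ ambiguitySet μ σ) {χ : ℝ → ℝ} {m q : ℝ}
    (hχ : Measurable χ) (h0 : ∀ v, 0 ≤ v → 0 ≤ χ v) (hm : 0 ≤ m)
    (htan : ∀ v, 0 ≤ v → χ (μ - σ / s) + m * (v - (μ - σ / s)) ≤ χ v)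
    (hq : q = χ (μ - σ / s) + m * (σ * (s + 1 / s)) / 2) (hq0 : 0 ≤ q) :
    q / (1 + s ^ 2) + s ^ 2 / (1 + s ^ 2) * χ (μ - σ / s)
      ≤ ∫ v : ℝ≥0, min q (χ v) ∂(G : Measure ℝ≥0) := by
  have hi := integrable_min (G := (G : Measure ℝ≥0)) hq0 hχ h0
  -- With zero variance the two atoms merge and the parabola below degenerates; demand is then `μ`
  -- almost surely.
  rcases hσ.eq_or_lt with rfl | hσ
  · obtain ⟨i, e⟩ := integral_quadratic_of_mem hG 0 (-1) μ
    have hae : (fun v : ℝ≥0 => 0 - (-1) * (μ - (v : ℝ)) ^ 2) =ᵐ[(G : Measure ℝ≥0)] 0 := by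
      refine (integral_eq_zero_iff_of_nonneg (fun v => ?_) i).1 (by rw [e]; ring)
      simp only [Pi.zero_apply]; nlinarith [sq_nonneg (μ - (v : ℝ))]
    have : (fun v : ℝ≥0 => min q (χ v)) =ᵐ[(G : Measure ℝ≥0)] fun _ => q := by
      filter_upwards [hae] with v hv
      have : (v : ℝ) = μ := by
        simp only [Pi.zero_apply] at hv
        have : (μ - (v : ℝ)) ^ 2 = 0 := by linarith
        have := pow_eq_zero_iff (two_ne_zero) |>.1 this
        linarith
      rw [this, hq]; simp
    rw [integral_congr_ae this]
    have h2 : χ (μ - 0 / s) = q := by rw [hq]; simp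
    rw [h2]
    simp
    apply le_of_eq
    field_simp
  · set a := μ - σ / s with ha
    have hD : 0 < σ * (s + 1 / s) := by positivity
    set D := σ * (s + 1 / s) with hDdef
    -- This curvature makes the parabola with peak `q` at the upper atom `a + D = μ + σ s` tangent
    -- at `a` to the supporting line of `χ`; `hq` is exactly the compatibility condition.
    set d := m / (2 * D) with hd
    have hd0 : 0 ≤ d := by positivity
    have hdD : 2 * d * D = m := by rw [hd]; field_simp
    obtain ⟨i, e⟩ := integral_quadratic_of_mem hG q d (a + D)
    have key : ∀ v : ℝ≥0, q - d * ((a + D) - v) ^ 2 ≤ min q (χ v) := by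
      intro v
      refine le_min ?_ (le_trans ?_ (htan v v.2))
      · nlinarith [mul_nonneg hd0 (sq_nonneg ((a + D) - (v : ℝ)))]
      · rw [hq, ← hdD]
        nlinarith [mul_nonneg hd0 (sq_nonneg (a - (v : ℝ)))]
    refine le_trans (le_of_eq ?_) (integral_mono i hi key)
    rw [e]
    have hc : χ a = q - d * D ^ 2 := by rw [hq, ← hdD]; ring
    rw [hc]
    have : (a + D - μ) = σ * s := by rw [ha, hDdef]; field_simp; ring
    rw [this, hDdef]
    field_simp
    ring

/-! ### Two-point laws and their couplings. -/

lemma twoPoint_isProbabilityMeasure {X : Type*} [MeasurableSpace X] {w : ℝ} (h0 : 0 ≤ w)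
    (h1 : w ≤ 1) (x y : X) :
    IsProbabilityMeasure (ENNReal.ofReal (1 - w) • Measure.dirac x +
      ENNReal.ofReal w • Measure.dirac y) := by
  constructor
  simp only [Measure.coe_add, Measure.coe_smul, Pi.add_apply, Pi.smul_apply, measure_univ,
    smul_eq_mul, mul_one]
  rw [← ENNReal.ofReal_add (by linarith) h0]
  simp

/-- The law with mass `1 - w` at `x` and mass `w` at `y`. -/
noncomputable def twoPoint {w : ℝ} (h0 : 0 ≤ w) (h1 : w ≤ 1) (x y : ℝ≥0) :
    ProbabilityMeasure ℝ≥0 :=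
  ⟨ENNReal.ofReal (1 - w) • Measure.dirac x + ENNReal.ofReal w • Measure.dirac y,
    twoPoint_isProbabilityMeasure h0 h1 x y⟩

lemma twoPoint_integral {w : ℝ} (h0 : 0 ≤ w) (h1 : w ≤ 1) (x y : ℝ≥0) (f : ℝ≥0 → ℝ) :
    Integrable f (twoPoint h0 h1 x y : Measure ℝ≥0) ∧
    ∫ v, f v ∂(twoPoint h0 h1 x y : Measure ℝ≥0) = (1 - w) * f x + w * f y := by
  have i : ∀ z : ℝ≥0, ∀ t : ℝ, Integrable f (ENNReal.ofReal t • Measure.dirac z) := fun z t =>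
    (integrable_dirac (by simp)).smul_measure (by simp)
  refine ⟨(i x _).add_measure (i y _), ?_⟩
  simp only [twoPoint, ProbabilityMeasure.coe_mk]
  rw [integral_add_measure (i x _) (i y _)]
  simp [h0, h1]

lemma twoPoint_mem {μ σ r : ℝ} (hμ : 0 < μ) (hσ : 0 ≤ σ) (hr : 0 < r) (hσr : σ ≤ μ * r)
    (h0 : 0 ≤ 1 / (1 + r ^ 2)) (h1 : 1 / (1 + r ^ 2) ≤ 1) :
    twoPoint h0 h1 (Real.toNNReal (μ - σ / r)) (Real.toNNReal (μ + σ * r)) ∈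
      ambiguitySet μ σ := by
  have ha : 0 ≤ μ - σ / r := by
    rw [sub_nonneg, div_le_iff₀ hr]; exact hσr
  have hb : 0 ≤ μ + σ * r := by positivity
  refine ⟨(twoPoint_integral h0 h1 _ _ _).1, ?_, ?_⟩ <;>
  · rw [(twoPoint_integral h0 h1 _ _ _).2, Real.coe_toNNReal _ ha, Real.coe_toNNReal _ hb]
    field_simp
    ring

/-- The law of a pair with mass `1 - w` at `(x, y)` and mass `w` at `(z, z)` couples two
two-point laws. -/
lemma otCost_twoPoint_le {w : ℝ} (h0 : 0 ≤ w) (h1 : w ≤ 1) (x y z : ℝ≥0) :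
    otCost (twoPoint h0 h1 x z) (twoPoint h0 h1 y z) ≤
      ENNReal.ofReal ((1 - w) * ((x : ℝ) - y) ^ 2) := by
  refine (iInf₂_le (ENNReal.ofReal (1 - w) • Measure.dirac (x, y) +
    ENNReal.ofReal w • Measure.dirac (z, z)) ⟨?_, ?_⟩).trans (le_of_eq ?_)
  · rw [lintegral_add_measure, lintegral_smul_measure, lintegral_smul_measure,
      lintegral_dirac, lintegral_dirac, ENNReal.ofReal_mul (by linarith)]
    simp
  · rw [Measure.map_add _ _ measurable_fst, Measure.map_smul, Measure.map_smul,
      Measure.map_dirac' measurable_fst, Measure.map_dirac' measurable_fst]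
    rfl
  · rw [Measure.map_add _ _ measurable_snd, Measure.map_smul, Measure.map_smul,
      Measure.map_dirac' measurable_snd, Measure.map_dirac' measurable_snd]
    rfl

lemma integral_profit (p c q : ℝ) (hq : 0 ≤ q) (F : ProbabilityMeasure ℝ≥0) :
    ∫ v, profit p c q v ∂(F : Measure ℝ≥0) =
      p * ∫ v : ℝ≥0, min q (v : ℝ) ∂(F : Measure ℝ≥0) - c * q := by
  have i : Integrable (fun v : ℝ≥0 => min q (v : ℝ)) (F : Measure ℝ≥0) :=
    integrable_min hq measurable_id fun _ h => h
  simp only [profit]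
  rw [integral_sub (i.const_mul p) (integrable_const _), integral_const_mul]
  simp

/-! ### The saddle-point argument. -/

/-- The profit bound given by the two-point law with parameter `r`, in terms of the function
`χ` which bounds the (cost-adjusted) sales. -/
noncomputable def twoPointBound (p c μ σ : ℝ) (χ : ℝ → ℝ) (q r : ℝ) : ℝ :=
  p * (q / (1 + r ^ 2) + r ^ 2 / (1 + r ^ 2) * χ (μ - σ / r)) - c * q

/-- The last factor is `qs - q`, so stationarity in `r` at `s` identifies the optimal quantity. -/
lemma hasDerivAt_twoPointBound {p c μ σ s q m : ℝ} {χ : ℝ → ℝ} (hs : 0 < s)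
    (hχ : HasDerivAt χ m (μ - σ / s)) :
    HasDerivAt (twoPointBound p c μ σ χ q)
      (p * (2 * s / (1 + s ^ 2) ^ 2) *
        (χ (μ - σ / s) + m * (σ * (s + 1 / s)) / 2 - q)) s := by
  have h1 : HasDerivAt (fun r : ℝ => 1 + r ^ 2) (2 * s) s := by
    simpa using (hasDerivAt_pow 2 s).const_add 1
  have h2 : HasDerivAt (fun r : ℝ => r ^ 2) (2 * s) s := by
    simpa using (hasDerivAt_pow 2 s)
  have hne : 1 + s ^ 2 ≠ 0 := by positivity
  have h3 : HasDerivAt (fun r : ℝ => μ - σ / r) (-((0 * s - σ * 1) / s ^ 2)) s :=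
    (((hasDerivAt_const s σ).div (hasDerivAt_id s) hs.ne')).const_sub μ
  have h4 := hχ.comp s h3
  have h5 := (((((hasDerivAt_const s q).div h1 hne).add
    ((h2.div h1 hne).mul h4)).const_mul p).sub_const (c * q))
  refine h5.congr_deriv ?_
  simp only [Function.comp, Pi.div_apply]
  field_simp
  ring

open Filter Topology in
lemma exists_gt_lt_of_deriv_neg {f : ℝ → ℝ} {x f' : ℝ} (hf : HasDerivAt f f' x) (h : f' < 0) :
    ∃ y > x, f y < f x := by
  have h1 := (hasDerivAt_iff_tendsto_slope.1 hf).mono_left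
    (nhdsWithin_mono x (fun y (hy : y ∈ Ioi x) => ne_of_gt hy))
  obtain ⟨y, hy, hxy⟩ := ((h1.eventually_lt_const h).and self_mem_nhdsWithin).exists
  refine ⟨y, hxy, ?_⟩
  rw [slope_def_field, div_neg_iff] at hy
  have : x < y := hxy
  rcases hy with hy | hy <;> linarith [hy.1, hy.2]

open Filter Topology in
lemma exists_lt_lt_of_deriv_pos {f : ℝ → ℝ} {x f' z : ℝ} (hf : HasDerivAt f f' x) (h : 0 < f')
    (hz : z < x) : ∃ y ∈ Ioo z x, f y < f x := by
  have h1 := (hasDerivAt_iff_tendsto_slope.1 hf).mono_left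
    (nhdsWithin_mono x (fun y (hy : y ∈ Iio x) => ne_of_lt hy))
  obtain ⟨y, hy, hxy⟩ := ((h1.eventually_const_lt h).and (Ioo_mem_nhdsLT hz)).exists
  refine ⟨y, hxy, ?_⟩
  rw [slope_def_field, div_pos_iff] at hy
  have := hxy.2
  rcases hy with hy | hy <;> linarith [hy.1, hy.2]

/-- Optimality of the order quantity `qs` for a criterion which is bounded above by the two-point
bounds and attains the bound with parameter `s`. -/
lemma optimalOrders_of_bounds {p c μ σ s qs m : ℝ} {χ : ℝ → ℝ} {L : ℝ → EReal}
    (hp : 0 < p) (hμ : 0 < μ) (hs : 0 < s) (hpc : p = c * (1 + s ^ 2)) (hσs : σ ≤ μ * s)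
    (hχ : HasDerivAt χ m (μ - σ / s))
    (hqs : qs = χ (μ - σ / s) + m * (σ * (s + 1 / s)) / 2) (hqs0 : 0 ≤ qs)
    (hlow : ((twoPointBound p c μ σ χ qs s : ℝ) : EReal) ≤ L qs)
    (hup : ∀ q, 0 ≤ q → ∀ r, 0 < r → σ ≤ μ * r →
      L q ≤ ((twoPointBound p c μ σ χ q r : ℝ) : EReal)) :
    IsGreatest (optimalOrders L) qs ∧
      (σ < μ * s ∨ qs = 0 → optimalOrders L = {qs}) := by
  -- The coefficient of `q` is `p / (1 + s²) - c = 0`.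
  have hval : ∀ q, twoPointBound p c μ σ χ q s = twoPointBound p c μ σ χ qs s := by
    intro q
    simp only [twoPointBound, hpc]
    field_simp
    ring
  have hopt : qs ∈ optimalOrders L := by
    refine ⟨hqs0, fun q hq => ?_⟩
    refine ((hup q hq s hs hσs).trans ?_).trans hlow
    rw [hval q]
  have hder := fun q => hasDerivAt_twoPointBound (p := p) (c := c) (q := q) hs hχ
  simp only [← hqs] at hder
  have hpos : 0 < p * (2 * s / (1 + s ^ 2) ^ 2) := by positivity
  have hcontra : ∀ q ∈ optimalOrders L, ∀ r, 0 < r → σ ≤ μ * r →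
      ¬ twoPointBound p c μ σ χ q r < twoPointBound p c μ σ χ q s := by
    intro q hq r hr hσr hlt
    rw [hval q] at hlt
    have h1 := (hlow.trans (hq.2 (show qs ∈ Ici 0 from hqs0))).trans (hup q hq.1 r hr hσr)
    exact absurd (EReal.coe_le_coe_iff.1 h1) (not_le.2 hlt)
  -- Increasing `r` is always admissible; decreasing it, as needed for `qs ≤ q`, requires `σ < μ *
  -- s`.
  have hle : ∀ q ∈ optimalOrders L, q ≤ qs := by
    intro q hq
    by_contra! hlt
    obtain ⟨r, hr, hlt'⟩ := exists_gt_lt_of_deriv_neg (hder q)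
      (mul_neg_of_pos_of_neg hpos (by linarith))
    exact hcontra q hq r (hs.trans hr) (hσs.trans (by gcongr)) hlt'
  refine ⟨⟨hopt, hle⟩, fun h => ?_⟩
  refine Subset.antisymm (fun q hq => ?_) (singleton_subset_iff.2 hopt)
  refine (hle q hq).antisymm ?_
  rcases h with h | h
  · by_contra! hlt
    have hz : max 0 (σ / μ) < s := max_lt hs ((div_lt_iff₀ hμ).2 (by linarith))
    obtain ⟨r, hr, hlt'⟩ := exists_lt_lt_of_deriv_pos (hder q)
      (mul_pos hpos (by linarith)) hz
    refine hcontra q hq r (lt_of_le_of_lt (le_max_left _ _) hr.1) ?_ hlt'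
    have := lt_of_le_of_lt (le_max_right _ _) hr.1
    rw [div_lt_iff₀ hμ] at this
    linarith
  · rw [h]; exact hq.1

/-! ### The Huber function and duality for the transport penalty. -/

/-- The infimal convolution `min_{u ≥ 0} (u + (u - v)² / (2 h))` on the nonnegative reals. -/
noncomputable def huber (h v : ℝ) : ℝ := (v ^ 2 - (max (v - h) 0) ^ 2) / (2 * h)

/-- `huber h` is convex with `1/h`-Lipschitz derivative `min a h / h`. The lower bound is the
supporting line for `le_integral_min`; both together give differentiability. -/
lemma huber_bounds {h : ℝ} (hh : 0 < h) (a v : ℝ) :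
    huber h a + min a h / h * (v - a) ≤ huber h v ∧
      huber h v ≤ huber h a + min a h / h * (v - a) + (v - a) ^ 2 / (2 * h) := by
  have e : huber h v - (huber h a + min a h / h * (v - a)) =
      ((v ^ 2 - (max (v - h) 0) ^ 2) - (a ^ 2 - (max (a - h) 0) ^ 2) -
        2 * min a h * (v - a)) / (2 * h) := by
    simp only [huber]; field_simp; ring
  have h2 : 0 ≤ (v ^ 2 - (max (v - h) 0) ^ 2) - (a ^ 2 - (max (a - h) 0) ^ 2) -
      2 * min a h * (v - a) ∧ (v ^ 2 - (max (v - h) 0) ^ 2) - (a ^ 2 - (max (a - h) 0) ^ 2) -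
      2 * min a h * (v - a) ≤ (v - a) ^ 2 := by
    rcases le_total v h with hv | hv <;> rcases le_total a h with ha | ha
    · rw [max_eq_right (by linarith), max_eq_right (by linarith), min_eq_left ha]
      constructor <;> nlinarith [sq_nonneg (v - a)]
    · rw [max_eq_right (by linarith), max_eq_left (by linarith), min_eq_right ha]
      constructor <;> nlinarith [sq_nonneg (v - h), mul_nonneg (sub_nonneg.2 hv) (sub_nonneg.2 ha)]
    · rw [max_eq_left (by linarith), max_eq_right (by linarith), min_eq_left ha]
      constructor <;> nlinarith [sq_nonneg (a - h), mul_nonneg (sub_nonneg.2 hv) (sub_nonneg.2 ha)]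
    · rw [max_eq_left (by linarith), max_eq_left (by linarith), min_eq_right ha]
      constructor <;> nlinarith [sq_nonneg (v - a)]
  constructor
  · have := div_nonneg h2.1 (show 0 ≤ 2 * h by positivity)
    linarith
  · have := div_le_div_of_nonneg_right h2.2 (show 0 ≤ 2 * h by positivity)
    linarith

lemma hasDerivAt_huber {h : ℝ} (hh : 0 < h) (a : ℝ) :
    HasDerivAt (huber h) (min a h / h) a := by
  rw [hasDerivAt_iff_isLittleO]
  refine Asymptotics.IsBigO.trans_isLittleO ?_ (Asymptotics.isLittleO_pow_sub_sub a one_lt_two)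
  refine Asymptotics.IsBigO.of_bound (1 / (2 * h)) (Filter.Eventually.of_forall fun v => ?_)
  obtain ⟨h1, h2⟩ := huber_bounds hh a v
  rw [smul_eq_mul, Real.norm_eq_abs, Real.norm_eq_abs, abs_of_nonneg (by linarith), abs_of_nonneg (sq_nonneg _),
    Real.norm_eq_abs, sq_abs, one_div, inv_mul_eq_div]
  linarith

lemma huber_nonneg {h : ℝ} (hh : 0 < h) (v : ℝ) : 0 ≤ huber h v := by
  have := (huber_bounds hh 0 v).1
  simpa [huber, hh.le] using this

lemma measurable_huber {h : ℝ} (hh : 0 < h) : Measurable (huber h) :=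
  (continuous_iff_continuousAt.2 fun a => (hasDerivAt_huber hh a).continuousAt).measurable

lemma huber_le {h u : ℝ} (hh : 0 < h) (hu : 0 ≤ u) (v : ℝ) :
    huber h v ≤ u + (u - v) ^ 2 / (2 * h) := by
  rw [huber, div_le_iff₀ (by positivity)]
  have : (u + (u - v) ^ 2 / (2 * h)) * (2 * h) = 2 * h * u + (u - v) ^ 2 := by field_simp
  rw [this]
  rcases le_total v h with hv | hv
  · rw [max_eq_right (by linarith)]
    nlinarith [mul_nonneg hu (sub_nonneg.2 hv)]
  · rw [max_eq_left (by linarith)]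
    nlinarith [sq_nonneg (u - (v - h))]

/-- The minimizer is `u = max (v - h) 0`; it dictates where the adversary moves the lower atom. -/
lemma huber_eq {h : ℝ} (hh : 0 < h) (v : ℝ) :
    huber h v = max (v - h) 0 + (max (v - h) 0 - v) ^ 2 / (2 * h) := by
  rw [huber]
  field_simp
  rcases le_total v h with hv | hv
  · rw [max_eq_right (by linarith)]; ring
  · rw [max_eq_left (by linarith)]; ring

lemma min_huber_le {h u : ℝ} (hh : 0 < h) (hu : 0 ≤ u) (q v : ℝ) :
    min q (huber h v) ≤ min q u + (u - v) ^ 2 / (2 * h) := by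
  have : 0 ≤ (u - v) ^ 2 / (2 * h) := by positivity
  rcases le_total q u with hq | hq
  · rw [min_eq_left hq]; linarith [min_le_left q (huber h v)]
  · rw [min_eq_right hq]; exact (min_le_right _ _).trans (huber_le hh hu v)

/-- The expected profit under `F` plus the transport cost to `G` dominates the expectation of the
infimal convolution under `G`. -/
lemma le_profit_add_transport {p c α h q : ℝ} (hα : 0 < α) (hh : 0 < h) (hp : p = 2 * α * h)
    (hq : 0 ≤ q) (F G : ProbabilityMeasure ℝ≥0) :
    ENNReal.ofReal (p * ∫ v : ℝ≥0, min q (huber h v) ∂(G : Measure ℝ≥0) - c * q -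
        ∫ u, profit p c q u ∂(F : Measure ℝ≥0)) ≤ ENNReal.ofReal α * otCost F G := by
  rw [otCost, ENNReal.mul_iInf_of_ne (by simpa using hα) (by simp)]
  refine le_iInf fun Γ => ?_
  rw [ENNReal.mul_iInf_of_ne (by simpa using hα) (by simp)]
  refine le_iInf fun hΓ => ?_
  have hprob : IsProbabilityMeasure Γ := by
    have : IsProbabilityMeasure (Γ.map Prod.fst) := by rw [hΓ.1]; infer_instance
    exact Measure.isProbabilityMeasure_of_map Prod.fst
  have hmeas : Measurable fun x : ℝ≥0 × ℝ≥0 => ((x.1 : ℝ) - x.2) ^ 2 := by fun_prop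
  by_cases htop : ∫⁻ x : ℝ≥0 × ℝ≥0, ENNReal.ofReal (((x.1 : ℝ) - (x.2 : ℝ)) ^ 2) ∂Γ = ⊤
  · rw [htop, ENNReal.mul_top (by simpa using hα)]; exact le_top
  have hint : Integrable (fun x : ℝ≥0 × ℝ≥0 => ((x.1 : ℝ) - x.2) ^ 2) Γ := by
    refine ⟨hmeas.aestronglyMeasurable, ?_⟩
    rw [hasFiniteIntegral_iff_ofReal (ae_of_all _ fun x => sq_nonneg _)]
    exact lt_top_iff_ne_top.2 htop
  rw [← ofReal_integral_eq_lintegral_ofReal hint (ae_of_all _ fun x => sq_nonneg _),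
    ← ENNReal.ofReal_mul hα.le]
  refine ENNReal.ofReal_le_ofReal ?_
  rw [integral_profit p c q hq F, ← hΓ.1, ← hΓ.2]
  have iG := integrable_min (G := Γ.map Prod.snd) hq (measurable_huber hh)
    fun v _ => huber_nonneg hh v
  have iF := integrable_min (G := Γ.map Prod.fst) hq measurable_id fun v h => h
  simp only [id] at iF
  rw [integral_map measurable_snd.aemeasurable iG.1, integral_map measurable_fst.aemeasurable iF.1]
  have iG' := iG.comp_measurable measurable_snd
  have iF' := iF.comp_measurable measurable_fst
  -- Integrating the pointwise inequality against the coupling gives weak duality.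
  have := integral_mono iG' (iF'.add (hint.div_const (2 * h)))
    fun x => min_huber_le hh x.1.2 q x.2
  rw [integral_add' iF' (hint.div_const (2 * h)), integral_div] at this
  simp only [Function.comp_def] at this
  have h2 := mul_le_mul_of_nonneg_left this (show 0 ≤ p by rw [hp]; positivity)
  rw [mul_add] at h2
  have h3 : p * ((∫ x : ℝ≥0 × ℝ≥0, ((x.1 : ℝ) - x.2) ^ 2 ∂Γ) / (2 * h)) =
    α * ∫ x : ℝ≥0 × ℝ≥0, ((x.1 : ℝ) - x.2) ^ 2 ∂Γ := by rw [hp]; field_simp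
  linarith

lemma le_misspecObjective {p c μ α σ h q V : ℝ} (hα : 0 < α) (hh : 0 < h) (hp : p = 2 * α * h)
    (hq : 0 ≤ q)
    (hV : ∀ G ∈ ambiguitySet μ σ,
      V ≤ p * ∫ v : ℝ≥0, min q (huber h v) ∂(G : Measure ℝ≥0) - c * q) :
    (V : EReal) ≤ misspecObjective p c μ α σ q := by
  refine le_iInf fun F => ?_
  set x := ∫ u, profit p c q u ∂(F : Measure ℝ≥0)
  have key : ENNReal.ofReal (V - x) ≤ ENNReal.ofReal α * distToSet F (ambiguitySet μ σ) := by
    rw [distToSet, ENNReal.mul_iInf_of_ne (by simpa using hα) (by simp)]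
    refine le_iInf fun G => ?_
    rw [ENNReal.mul_iInf_of_ne (by simpa using hα) (by simp)]
    refine le_iInf fun hG => le_trans (ENNReal.ofReal_le_ofReal ?_)
      (le_profit_add_transport (c := c) hα hh hp hq F G)
    linarith [hV G hG]
  calc (V : EReal) = (x : EReal) + ((V - x : ℝ) : EReal) := by
        rw [← EReal.coe_add]; congr 1; ring
    _ ≤ (x : EReal) + ((ENNReal.ofReal (V - x) : ℝ≥0∞) : EReal) := by
        gcongr
        rw [EReal.coe_ennreal_ofReal]
        exact EReal.coe_le_coe_iff.2 (le_max_left _ _)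
    _ ≤ _ := by
        gcongr
        exact EReal.coe_ennreal_le_coe_ennreal_iff.2 key

lemma misspecObjective_le {p c μ α σ h q r : ℝ} (hα : 0 < α) (hh : 0 < h) (hp : p = 2 * α * h)
    (hμ : 0 < μ) (hσ : 0 ≤ σ) (hr : 0 < r) (hσr : σ ≤ μ * r) :
    misspecObjective p c μ α σ q ≤ ((twoPointBound p c μ σ (huber h) q r : ℝ) : EReal) := by
  have h0 : 0 ≤ 1 / (1 + r ^ 2) := by positivity
  have h1 : 1 / (1 + r ^ 2) ≤ 1 := by rw [div_le_one (by positivity)]; nlinarith [sq_nonneg r]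
  have hp0 : 0 < p := by rw [hp]; positivity
  have ha : 0 ≤ μ - σ / r := by
    rw [sub_nonneg, div_le_iff₀ hr]; exact hσr
  have hmem := twoPoint_mem hμ hσ hr hσr h0 h1
  set a := μ - σ / r with hadef
  set z := Real.toNNReal (μ + σ * r)
  set x := Real.toNNReal (max (a - h) 0)
  have hx : (x : ℝ) = max (a - h) 0 := Real.coe_toNNReal _ (le_max_right _ _)
  -- Only the lower atom is transported, from `a` to the Huber minimizer; the upper one stays put.
  refine (iInf_le _ (twoPoint h0 h1 x z)).trans ?_
  have hd : ENNReal.ofReal α * distToSet (twoPoint h0 h1 x z) (ambiguitySet μ σ) ≤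
      ENNReal.ofReal (α * ((1 - 1 / (1 + r ^ 2)) * ((x : ℝ) - Real.toNNReal a) ^ 2)) := by
    rw [ENNReal.ofReal_mul hα.le]
    gcongr
    exact (iInf₂_le _ hmem).trans (otCost_twoPoint_le h0 h1 _ _ _)
  refine (add_le_add_right (EReal.coe_ennreal_le_coe_ennreal_iff.2 hd) _).trans ?_
  have h1' : 0 ≤ 1 - 1 / (1 + r ^ 2) := by linarith
  rw [EReal.coe_ennreal_ofReal, max_eq_left (by positivity), ← EReal.coe_add,
    EReal.coe_le_coe_iff, (twoPoint_integral h0 h1 x z _).2, Real.coe_toNNReal a ha]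
  simp only [profit, twoPointBound]
  rw [← hadef, huber_eq hh a, ← hx]
  have e : r ^ 2 / (1 + r ^ 2) = 1 - 1 / (1 + r ^ 2) := by field_simp; ring
  rw [e]
  have e2 : q / (1 + r ^ 2) = 1 / (1 + r ^ 2) * q := by ring
  rw [e2]
  generalize 1 / (1 + r ^ 2) = w at *
  have e3 : p * ((1 - w) * (((x : ℝ) - a) ^ 2 / (2 * h))) = α * ((1 - w) * ((x : ℝ) - a) ^ 2) := by
    rw [hp]; field_simp
  have m1 := mul_le_mul_of_nonneg_left (min_le_right q (x : ℝ)) (mul_nonneg hp0.le h1')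
  have m2 := mul_le_mul_of_nonneg_left (min_le_left q (z : ℝ)) (mul_nonneg hp0.le h0)
  nlinarith

/-! ### Optimal quantities of the two problems. -/

lemma scarfObjective_le {p c μ σ q r : ℝ} (hp0 : 0 < p)
    (hμ : 0 < μ) (hσ : 0 ≤ σ) (hr : 0 < r) (hσr : σ ≤ μ * r) :
    scarfObjective p c μ σ q ≤ ((twoPointBound p c μ σ id q r : ℝ) : EReal) := by
  have h0 : 0 ≤ 1 / (1 + r ^ 2) := by positivity
  have h1 : 1 / (1 + r ^ 2) ≤ 1 := by rw [div_le_one (by positivity)]; nlinarith [sq_nonneg r]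
  have ha : 0 ≤ μ - σ / r := by
    rw [sub_nonneg, div_le_iff₀ hr]; exact hσr
  refine (iInf₂_le _ (twoPoint_mem hμ hσ hr hσr h0 h1)).trans ?_
  set a := μ - σ / r with hadef
  set z := Real.toNNReal (μ + σ * r)
  rw [EReal.coe_le_coe_iff, (twoPoint_integral h0 h1 _ z _).2]
  simp only [profit, twoPointBound, Real.coe_toNNReal a ha, id]
  rw [← hadef]
  have e : r ^ 2 / (1 + r ^ 2) = 1 - 1 / (1 + r ^ 2) := by field_simp; ring
  have e2 : q / (1 + r ^ 2) = 1 / (1 + r ^ 2) * q := by ring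
  rw [e, e2]
  have h1' : 0 ≤ 1 - 1 / (1 + r ^ 2) := by linarith
  generalize 1 / (1 + r ^ 2) = w at *
  have m1 := mul_le_mul_of_nonneg_left (min_le_right q a) (mul_nonneg hp0.le h1')
  have m2 := mul_le_mul_of_nonneg_left (min_le_left q (z : ℝ)) (mul_nonneg hp0.le h0)
  nlinarith

lemma scarf_optimalOrders {p c μ σ s : ℝ} (hp : 0 < p) (hμ : 0 < μ) (hs : 0 < s)
    (hpc : p = c * (1 + s ^ 2)) (hσ : 0 ≤ σ) (hσs : σ ≤ μ * s) :
    IsGreatest (optimalOrders (scarfObjective p c μ σ)) (μ - σ / s + σ * (s + 1 / s) / 2) ∧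
      (σ < μ * s → optimalOrders (scarfObjective p c μ σ) =
        {μ - σ / s + σ * (s + 1 / s) / 2}) := by
  have ha : 0 ≤ μ - σ / s := by
    rw [sub_nonneg, div_le_iff₀ hs]; exact hσs
  have hq0 : 0 ≤ μ - σ / s + σ * (s + 1 / s) / 2 := by positivity
  have := optimalOrders_of_bounds (qs := μ - σ / s + σ * (s + 1 / s) / 2) (m := 1) (χ := id)
    (L := scarfObjective p c μ σ) hp hμ hs hpc hσs (hasDerivAt_id _)
    (by simp) hq0 ?_ fun q _ r hr hσr => scarfObjective_le hp hμ hσ hr hσr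
  · exact ⟨this.1, fun h => this.2 (Or.inl h)⟩
  · refine le_iInf₂ fun G hG => EReal.coe_le_coe_iff.2 ?_
    rw [integral_profit p c _ hq0 G, twoPointBound]
    have := le_integral_min hs hσ hG measurable_id (fun _ h => h) zero_le_one
      (fun v _ => by simp) (q := μ - σ / s + σ * (s + 1 / s) / 2) (by simp) hq0
    have := mul_le_mul_of_nonneg_left this hp.le
    simp only [id] at this ⊢
    linarith

/-- The optimal order quantity under misspecification aversion, where `h = p / (2 α)`. -/
noncomputable def misspecOrder (μ s h σ : ℝ) : ℝ :=
  huber h (μ - σ / s) + min (μ - σ / s) h / h * (σ * (s + 1 / s)) / 2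

lemma misspec_optimalOrders {p c μ α h σ s : ℝ} (hα : 0 < α) (hh : 0 < h) (hp : p = 2 * α * h)
    (hμ : 0 < μ) (hs : 0 < s) (hpc : p = c * (1 + s ^ 2)) (hσ : 0 ≤ σ) (hσs : σ ≤ μ * s) :
    optimalOrders (misspecObjective p c μ α σ) = {misspecOrder μ s h σ} := by
  have hp0 : 0 < p := by rw [hp]; positivity
  have ha : 0 ≤ μ - σ / s := by
    rw [sub_nonneg, div_le_iff₀ hs]; exact hσs
  have hm : 0 ≤ min (μ - σ / s) h / h := div_nonneg (le_min ha hh.le) hh.le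
  have hq0 : 0 ≤ misspecOrder μ s h σ := by
    have := huber_nonneg hh (μ - σ / s)
    unfold misspecOrder
    positivity
  refine (optimalOrders_of_bounds (χ := huber h) hp0 hμ hs hpc hσs (hasDerivAt_huber hh _)
    rfl hq0 ?_ fun q _ r hr hσr => misspecObjective_le hα hh hp hμ hσ hr hσr).2 ?_
  · refine le_misspecObjective hα hh hp hq0 fun G hG => ?_
    have := le_integral_min hs hσ hG (measurable_huber hh) (fun v _ => huber_nonneg hh v) hm
      (fun v _ => (huber_bounds hh _ v).1) (q := misspecOrder μ s h σ) rfl hq0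
    have := mul_le_mul_of_nonneg_left this hp0.le
    exact sub_le_sub_right this _
  -- At `σ = μ * s` the lower atom is `0`, where `huber` and its slope vanish; the quantity is then
  -- `0`, and `q ≥ 0` supplies uniqueness.
  · rcases hσs.lt_or_eq with h1 | h1
    · exact Or.inl h1
    · right
      have : μ - σ / s = 0 := by rw [h1]; field_simp; ring
      simp [this, huber, hh.le]

/-- With no penalty, demand identically zero is free for the adversary, leaving only the loss `-(c *
q)`. -/
lemma misspec_optimalOrders_zero {p c μ σ : ℝ} (hc : 0 < c) :
    optimalOrders (misspecObjective p c μ 0 σ) = {0} := by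
  have hup : ∀ q, 0 ≤ q → misspecObjective p c μ 0 σ q ≤ ((-(c * q) : ℝ) : EReal) := by
    intro q hq
    refine (iInf_le _ (twoPoint le_rfl zero_le_one 0 0)).trans ?_
    simp [(twoPoint_integral le_rfl zero_le_one 0 0 _).2, profit, hq]
  have hlow : (0 : EReal) ≤ misspecObjective p c μ 0 σ 0 := by
    refine le_iInf fun F => ?_
    simp [profit]
  refine Subset.antisymm (fun q hq => ?_) (singleton_subset_iff.2 ⟨le_refl (0 : ℝ), fun q hq => ?_⟩)
  · have h1 := (hlow.trans (hq.2 (show (0 : ℝ) ∈ Ici 0 from le_refl (0 : ℝ)))).trans (hup q hq.1)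
    have h2 : (0 : ℝ) ≤ -(c * q) := EReal.coe_le_coe_iff.1 h1
    have := hq.1
    refine le_antisymm ?_ this
    by_contra! h3
    nlinarith
  · refine ((hup q hq).trans ?_).trans hlow
    have : -(c * q) ≤ 0 := by have := mul_nonneg hc.le (show 0 ≤ q from hq); linarith
    exact EReal.coe_le_coe_iff.2 this

/-- Beyond `s * (μ - h)` the lower atom lies in the quadratic range of `huber`, so the order is a
concave quadratic in `σ` with vertex `μ * (s - 1 / s) / 2`. -/
lemma misspecOrder_antitoneOn {μ s h : ℝ} (hs : 0 < s) (hh : 0 < h) :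
    AntitoneOn (misspecOrder μ s h)
      (Icc (max 0 (max (μ * (s - 1 / s) / 2) (s * (μ - h)))) (μ * s)) := by
  have hform : ∀ σ, s * (μ - h) ≤ σ → misspecOrder μ s h σ =
      (μ ^ 2 + μ * (s - 1 / s) * σ - σ ^ 2) / (2 * h) := by
    intro σ h1
    have h2 : μ - σ / s ≤ h := by
      have : μ - h ≤ σ / s := by rw [le_div_iff₀ hs]; linarith
      linarith
    rw [misspecOrder, huber, min_eq_left h2, max_eq_right (by linarith)]
    field_simp
    ring
  intro x hx y hy hxy
  have h1 := fun z (hz : z ∈ Icc (max 0 (max (μ * (s - 1 / s) / 2) (s * (μ - h)))) (μ * s)) =>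
    max_le_iff.1 (max_le_iff.1 hz.1).2
  rw [hform x (h1 x hx).2, hform y (h1 y hy).2]
  have := (h1 x hx).1
  refine div_le_div_of_nonneg_right ?_ (by positivity)
  nlinarith

end Newsvendor

/-! ### Assembly and comparative statics. -/

theorem proposition3 (p c μ α : ℝ) (hc : 0 < c) (hcp : c < p) (hμ : 0 < μ) (hα : 0 ≤ α)
    (hκ : 1 / 2 ≤ Newsvendor.margin p c) :
    ∃ qα qS : ℝ → ℝ,
      -- the optimal order quantity under misspecification aversion, which is unique
      (∀ σ ∈ Set.Icc 0 (μ * √(Newsvendor.margin p c / (1 - Newsvendor.margin p c))),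
        Newsvendor.optimalOrders (Newsvendor.misspecObjective p c μ α σ) = {qα σ}) ∧
      -- the Scarf order quantity: unique below the right end, the largest optimal one there
      (∀ σ ∈ Set.Ico 0 (μ * √(Newsvendor.margin p c / (1 - Newsvendor.margin p c))),
        Newsvendor.optimalOrders (Newsvendor.scarfObjective p c μ σ) = {qS σ}) ∧
      (∀ σ ∈ Set.Icc 0 (μ * √(Newsvendor.margin p c / (1 - Newsvendor.margin p c))),
        IsGreatest (Newsvendor.optimalOrders (Newsvendor.scarfObjective p c μ σ)) (qS σ)) ∧
      (∃ σα : ℝ, 0 ≤ σα ∧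
        σα < μ * √(Newsvendor.margin p c / (1 - Newsvendor.margin p c)) ∧
        AntitoneOn qα
          (Set.Icc σα (μ * √(Newsvendor.margin p c / (1 - Newsvendor.margin p c))))) ∧
      MonotoneOn qS
        (Set.Icc 0 (μ * √(Newsvendor.margin p c / (1 - Newsvendor.margin p c)))) := by
  have hp : 0 < p := hc.trans hcp
  have hκ1 : Newsvendor.margin p c / (1 - Newsvendor.margin p c) = (p - c) / c := by
    rw [Newsvendor.margin]
    have : 1 - (p - c) / p = c / p := by field_simp; ring
    rw [this]
    field_simp
  have hone : 1 ≤ (p - c) / c := by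
    rw [Newsvendor.margin, le_div_iff₀ hp] at hκ
    rw [le_div_iff₀ hc]
    linarith
  rw [hκ1]
  set s := √((p - c) / c) with hsdef
  -- This is `κ ≥ 1/2`; it makes the Scarf slope `(s - 1/s)/2` nonnegative.
  have hs1 : 1 ≤ s := Real.one_le_sqrt.2 hone
  have hs : 0 < s := by linarith
  have hpc : p = c * (1 + s ^ 2) := by
    rw [hsdef, Real.sq_sqrt (by linarith)]
    field_simp
    ring
  have hinv : 1 / s ≤ s := by
    rw [div_le_iff₀ hs]; nlinarith
  have hscarf := fun σ (hσ : σ ∈ Set.Icc 0 (μ * s)) =>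
    Newsvendor.scarf_optimalOrders hp hμ hs hpc hσ.1 hσ.2
  obtain ⟨qα, hqα, hanti⟩ : ∃ qα : ℝ → ℝ,
      (∀ σ ∈ Set.Icc 0 (μ * s),
        Newsvendor.optimalOrders (Newsvendor.misspecObjective p c μ α σ) = {qα σ}) ∧
      ∃ σα : ℝ, 0 ≤ σα ∧ σα < μ * s ∧ AntitoneOn qα (Set.Icc σα (μ * s)) := by
    rcases hα.eq_or_lt with rfl | hα
    · exact ⟨fun _ => 0, fun σ _ => Newsvendor.misspec_optimalOrders_zero hc, 0, le_rfl,
        by positivity, antitoneOn_const⟩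
    · have hh : 0 < p / (2 * α) := by positivity
      refine ⟨Newsvendor.misspecOrder μ s (p / (2 * α)), fun σ hσ =>
        Newsvendor.misspec_optimalOrders hα hh (by field_simp) hμ hs hpc hσ.1 hσ.2,
        _, le_max_left _ _, ?_, Newsvendor.misspecOrder_antitoneOn hs hh⟩
      have : 0 < 1 / s := by positivity
      refine max_lt (by positivity) (max_lt ?_ ?_) <;> nlinarith [mul_pos hμ this, mul_pos hs hh,
        mul_pos hμ hs]
  refine ⟨qα, fun σ => μ - σ / s + σ * (s + 1 / s) / 2, hqα,
    fun σ hσ => (hscarf σ ⟨hσ.1, hσ.2.le⟩).2 hσ.2, fun σ hσ => (hscarf σ hσ).1, hanti, ?_⟩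
  intro x _ y _ hxy
  have e : ∀ σ : ℝ, μ - σ / s + σ * (s + 1 / s) / 2 = μ + σ * ((s - 1 / s) / 2) := by
    intro σ; field_simp; ring
  simp only [e]
  have : 0 ≤ (s - 1 / s) / 2 := by linarith
  gcongr
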